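/- Let $n\ge 1$ and $k\ge 1$ be integers, $I^n=[0,1]^n$, and let $$\mathcal K_k^n=\Big\{\prod_{s=1}^n\Big[\tfrac{i_s-1}{k},\tfrac{i_s}{k}\Big] : i_1,\dots,i_n\in\{1,\dots,k\}\Big\}$$ be the division of $I^n$ into $k^n$ cubes. A set $S\subset I^n$ *connects some opposite faces of $I^n$* if $S$ is connected and, for some $i\in\{1,\dots,n\}$, it meets both $\{z\in I^n: z_i=0\}$ and $\{z\in I^n: z_i=1\}$. A set $P\subset\mathbb Z^{n-1}$ is *$1$-connected* if any two of its points are joined by a finite sequence of points of $P$ whose consecutive terms are at $\ell^\infty$-distance at most $1$. Write $\dim$ for topological dimension, where $\dim\emptyset<0$ by convention. For $0\le m\le n-1$ call a real number $C>0$ *admissible for $(n,m)$* if for every integer $k\ge1$ and every function $F:\mathcal K_k^n\to\mathbb Z^{n-1}$ such that $\|F(K_1)-F(K_2)\|_\infty\le 1$ for all $K_1,K_2\in\mathcal K_k^n$ with $\dim(K_1\cap K_2)\ge m$, there exist a $1$-connected set $P\subset\mathbb Z^{n-1}$ with $|P|\le C$ and a family $\mathcal S\subset F^{-1}[P]$ such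 that $\bigcup\mathcal S$ connects some opposite faces of $I^n$. Let $\widehat C_{n,m}$ denote the minimum of all admissible constants for $(n,m)$. Then $\widehat C_{3,0}=2$; that is, $2$ is admissible for $(3,0)$, and no real number $0<C<2$ is admissible for $(3,0)$. -/

import Mathlib

namespace Chessboard

/-- The topological dimension of a subset `A` of `ℝ^n`, with `dim ∅ = ⊥`. For subsets of `ℝ^n`
the inductive and the covering dimensions coincide. -/
noncomputable def topDim {n : ℕ} (A : Set (Fin n → ℝ)) : WithBot ℕ∞ :=
  smallInductiveDimension A

/-- The unit cube `I^n = [0, 1]^n`. -/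
def unitCube (n : ℕ) : Set (Fin n → ℝ) :=
  Set.univ.pi fun _ => Set.Icc (0 : ℝ) 1

/-- The cube `∏ s, [i_s / k, (i_s + 1) / k]`, where the indices `i_s` run over `0, …, k - 1`. -/
def cube (n k : ℕ) (i : Fin n → Fin k) : Set (Fin n → ℝ) :=
  Set.univ.pi fun s => Set.Icc (((i s : ℕ) : ℝ) / (k : ℝ)) ((((i s : ℕ) : ℝ) + 1) / (k : ℝ))

/-- The family `𝒦_k^n` of the `k^n` cubes into which `I^n` is divided. -/
def cubes (n k : ℕ) : Set (Set (Fin n → ℝ)) :=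
  Set.range (cube n k)

/-- `S ⊆ I^n` connects the `i`th opposite faces `{z ∈ I^n | z_i = 0}`, `{z ∈ I^n | z_i = 1}`. -/
def ConnectsOppositeFaces {n : ℕ} (i : Fin n) (S : Set (Fin n → ℝ)) : Prop :=
  S ⊆ unitCube n ∧ IsConnected S ∧
    (S ∩ {z | z ∈ unitCube n ∧ z i = 0}).Nonempty ∧
    (S ∩ {z | z ∈ unitCube n ∧ z i = 1}).Nonempty

/-- `S` connects some opposite faces of `I^n`. -/
def ConnectsSomeOppositeFaces {n : ℕ} (S : Set (Fin n → ℝ)) : Prop :=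
  ∃ i : Fin n, ConnectsOppositeFaces i S

/-- `S` is `r`-connected: any two of its points are joined by a finite sequence of points of `S`
whose consecutive terms are at distance at most `r`. -/
def RConnected {X : Type*} [MetricSpace X] (r : ℝ) (S : Set X) : Prop :=
  ∀ x ∈ S, ∀ y ∈ S, ∃ (N : ℕ) (p : Fin (N + 1) → X),
    (∀ j, p j ∈ S) ∧ p 0 = x ∧ p (Fin.last N) = y ∧
      ∀ j : Fin N, dist (p j.castSucc) (p j.succ) ≤ r

/-- `C` is an admissible constant in dimension `n ≥ 1` with parameter `0 ≤ m ≤ n - 1`: for every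
`k ≥ 1` and every `F : 𝒦_k^n → ℤ^(n-1)` with `‖F K₁ - F K₂‖_∞ ≤ 1` whenever
`dim (K₁ ∩ K₂) ≥ m`, there are a `1`-connected `P ⊆ ℤ^(n-1)` with `|P| ≤ C` and a family
`𝒮 ⊆ F⁻¹[P]` whose union connects some opposite faces of `I^n`.
Norm and distance on `Fin (n - 1) → ℤ` are those of `l^∞`. -/
def AdmissibleConst (n m : ℕ) (C : ℝ) : Prop :=
  ∀ (k : ℕ), 1 ≤ k → ∀ F : cubes n k → (Fin (n - 1) → ℤ),
    (∀ K₁ K₂ : cubes n k,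
      (m : WithBot ℕ∞) ≤ topDim ((K₁ : Set (Fin n → ℝ)) ∩ (K₂ : Set (Fin n → ℝ))) →
        ‖F K₁ - F K₂‖ ≤ 1) →
    ∃ P : Finset (Fin (n - 1) → ℤ),
      RConnected 1 (P : Set (Fin (n - 1) → ℤ)) ∧ (P.card : ℝ) ≤ C ∧
      ∃ 𝒮 : Set (cubes n k), 𝒮 ⊆ F ⁻¹' (P : Set (Fin (n - 1) → ℤ)) ∧
        ConnectsSomeOppositeFaces (⋃ K ∈ 𝒮, (K : Set (Fin n → ℝ)))

/-- `C` is the optimal constant `Ĉ_{n,m}`: the minimum of all admissible constants `C > 0`. -/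
def IsOptimalConst (n m : ℕ) (C : ℝ) : Prop :=
  IsLeast {c : ℝ | 0 < c ∧ AdmissibleConst n m c} C

end Chessboard

/-!
Upper bound. Suppose that no component of the union of the cubes of one colour joins opposite faces,
and call two cubes equivalent if they lie in the same component. For `i < n`, let `s i` consist of
the cubes that are equivalent to a cube touching the face `z i = 0`; it contains the cubes on this
face and avoids those on the opposite one. Let `s n` consist of all cubes. Triangulate the grid of
cubes in Freudenthal's way and sum, modulo `2` and over all `n`-simplices, the determinant of the
values at the vertices of the indicators of `s 0`, `s 0 ∪ s 1`, …, `s 0 ∪ ⋯ ∪ s n`. Since the last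
of these functions is `1`, the Laplace expansion exhibits this determinant as the coboundary of the
determinant of the first `n` functions on `(n - 1)`-simplices. The sum thus reduces to the boundary
of the grid, where only the face `z (n - 1) = 0` contributes; there the `n`-th function is again
`1`, and by induction the sum equals `1`. A simplex with nonzero determinant consists of `n + 1`
pairwise intersecting cubes in distinct classes, hence of distinct colours. For `n = 3`, colour each
cube by the domino that contains its value, for the brick wall tiling of `ℤ²`: the four values would
be pairwise adjacent and lie in four distinct dominoes, but a `2 × 2` block meets only three.

Lower bound. For `k = 3` the cubes can be coloured by the four points of a `2 × 2` block, all of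
which are adjacent, so that no component of one colour joins opposite faces.
-/

namespace Chessboard

open Finset

section Freudenthal

variable {ι X R : Type*}

/-- The simplicial coboundary of a cochain `φ`, without signs: it is meant for coefficients of
characteristic `2`. -/
def coboundary [AddCommMonoid R] {k : ℕ} (φ : (Fin (k + 1) → X) → R) (w : Fin (k + 2) → X) : R :=
  ∑ j, φ (Fin.removeNth j w)

theorem coboundary_cons [AddCommMonoid R] {k : ℕ} (φ : (Fin (k + 2) → X) → R) (x : X)
    (w : Fin (k + 2) → X) :
    coboundary φ (Fin.cons x w) = φ w + coboundary (fun v => φ (Fin.cons x v)) w := by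
  simp only [coboundary, Fin.sum_univ_succ (n := k + 2), Fin.removeNth_zero, Fin.tail_cons]
  congr! 3 with j
  exact Fin.cons_comp_succ_succAbove ..

variable [DecidableEq ι] [AddCommMonoid X]

/-- The sum of the cochain `φ` over the Freudenthal simplices
`x, x + e a₁, …, x + e a₁ + ⋯ + e aₖ`, where `a₁, …, aₖ` are distinct elements of `A`. If `A` has
`k` elements, these simplices triangulate the cube spanned at `x` by the vectors `e a`, `a ∈ A`. -/
def cubeSum [AddCommMonoid R] (e : ι → X) :
    (k : ℕ) → Finset ι → ((Fin (k + 1) → X) → R) → X → R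
  | 0, _, φ, x => φ fun _ => x
  | k + 1, A, φ, x => ∑ a ∈ A, cubeSum e k (A.erase a) (fun w => φ (Fin.cons x w)) (x + e a)

theorem cubeSum_add [AddCommMonoid R] (e : ι → X) (k : ℕ) (A : Finset ι)
    (φ ψ : (Fin (k + 1) → X) → R) (x : X) :
    cubeSum e k A (fun w => φ w + ψ w) x = cubeSum e k A φ x + cubeSum e k A ψ x := by
  induction k generalizing A x with
  | zero => rfl
  | succ k ih => simp only [cubeSum, ih, sum_add_distrib]

theorem cubeSum_zero [AddCommMonoid R] (e : ι → X) (k : ℕ) (A : Finset ι) (x : X) :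
    cubeSum e k A (fun _ => (0 : R)) x = 0 := by
  induction k generalizing A x with
  | zero => rfl
  | succ k ih => simp only [cubeSum, ih, sum_const_zero]

theorem cubeSum_congr [AddCommMonoid R] {e : ι → X} {k : ℕ} {A : Finset ι}
    {φ ψ : (Fin (k + 1) → X) → R} {x : X}
    (h : ∀ w, (∀ j, ∃ B ⊆ A, w j = x + ∑ b ∈ B, e b) → φ w = ψ w) :
    cubeSum e k A φ x = cubeSum e k A ψ x := by
  induction k generalizing A x with
  | zero => exact h _ fun _ => ⟨∅, empty_subset A, by simp⟩
  | succ k ih =>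
    refine sum_congr rfl fun a ha => ih fun w hw => h _ (Fin.cases ⟨∅, empty_subset A, by simp⟩ ?_)
    intro j
    obtain ⟨B, hB, hwj⟩ := hw j
    refine ⟨insert a B, insert_subset ha (hB.trans (erase_subset a A)), ?_⟩
    rw [Fin.cons_succ, hwj, sum_insert fun haB => notMem_erase a A (hB haB), add_assoc]

theorem cubeSum_eq_zero [AddCommMonoid R] {e : ι → X} {k : ℕ} {A : Finset ι}
    {φ : (Fin (k + 1) → X) → R} {x : X}
    (h : ∀ w, (∀ j, ∃ B ⊆ A, w j = x + ∑ b ∈ B, e b) → φ w = 0) : cubeSum e k A φ x = 0 :=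
  (cubeSum_congr h).trans (cubeSum_zero e k A x)

theorem sum_sum_erase_comm [AddCommMonoid R] (A : Finset ι) (f : ι → ι → R) :
    ∑ a ∈ A, ∑ b ∈ A.erase a, f a b = ∑ b ∈ A, ∑ a ∈ A.erase b, f a b :=
  sum_comm' fun a b => by grind

theorem sum_sum_erase_eq_zero [Ring R] [CharP R 2] (A : Finset ι) {f : ι → ι → R}
    (hf : ∀ a b, f a b = f b a) : ∑ a ∈ A, ∑ b ∈ A.erase a, f a b = 0 := by
  rw [sum_sigma']
  refine sum_involution (fun p _ => ⟨p.2, p.1⟩) ?_ ?_ ?_ ?_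
  · rintro ⟨a, b⟩ -
    rw [hf b a, CharTwo.add_self_eq_zero]
  · rintro ⟨a, b⟩ _ - h
    grind
  · rintro ⟨a, b⟩ _
    grind
  · rintro ⟨a, b⟩ _
    grind

/-- Facets of the triangulation that are interior to the cube cancel in pairs: two consecutive
steps can be made in either order. -/
theorem cubeSum_coboundary [Ring R] [CharP R 2] (e : ι → X) (k : ℕ) (A : Finset ι)
    (φ : (Fin (k + 1) → X) → R) (x : X) :
    cubeSum e (k + 1) A (coboundary φ) x =
      ∑ a ∈ A, (cubeSum e k (A.erase a) φ (x + e a) + cubeSum e k (A.erase a) φ x) := by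
  induction k generalizing A x with
  | zero =>
    refine sum_congr rfl fun a _ => ?_
    have removeNth_one : Fin.removeNth 1 (Fin.cons x fun _ => x + e a : Fin 2 → X) = fun _ => x :=
      funext fun i => by rw [Subsingleton.elim i 0]; rfl
    rw [cubeSum, coboundary, Fin.sum_univ_two, removeNth_one]
    rfl
  | succ k ih =>
    have inner : ∑ a ∈ A, cubeSum e (k + 1) (A.erase a) (coboundary fun w => φ (Fin.cons x w))
        (x + e a) = ∑ a ∈ A, cubeSum e (k + 1) (A.erase a) φ x := by
      simp only [ih, sum_add_distrib]
      rw [sum_sum_erase_eq_zero A fun a b => by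
        rw [erase_right_comm, add_right_comm x], zero_add,
        sum_sum_erase_comm]
      simp only [cubeSum, erase_right_comm (s := A)]
    rw [cubeSum]
    simp only [coboundary_cons, cubeSum_add, sum_add_distrib]
    rw [inner]

end Freudenthal

section Box

variable {ι R : Type*} {A : Finset ι} {a : ι} {m : ℕ}

/-- The points of the grid `{0, …, m - 1} ^ A`, extended by `0` outside `A`: the lower corners of
the unit cubes that make up `[0, m] ^ A`. -/
noncomputable def box (A : Finset ι) (m : ℕ) : Finset (ι →₀ ℕ) :=
  A.finsupp fun _ => range m

theorem mem_box_iff {x : ι →₀ ℕ} : x ∈ box A m ↔ x.support ⊆ A ∧ ∀ a ∈ A, x a < m := by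
  simp only [box, mem_finsupp_iff, mem_range]

theorem apply_eq_zero_of_mem_box {x : ι →₀ ℕ} (hx : x ∈ box A m) (ha : a ∉ A) : x a = 0 :=
  Finsupp.notMem_support_iff.1 fun h => ha ((mem_box_iff.1 hx).1 h)

variable [DecidableEq ι]

theorem erase_mem_box {x : ι →₀ ℕ} (hx : x ∈ box A m) : x.erase a ∈ box (A.erase a) m := by
  rw [mem_box_iff] at hx ⊢
  rw [Finsupp.support_erase]
  refine ⟨erase_subset_erase a hx.1, fun i hi => ?_⟩
  rw [Finsupp.erase_ne (ne_of_mem_erase hi)]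
  exact hx.2 i (mem_of_mem_erase hi)

theorem add_single_mem_box (ha : a ∈ A) {y : ι →₀ ℕ} (hy : y ∈ box (A.erase a) m) {c : ℕ}
    (hc : c < m) : y + Finsupp.single a c ∈ box A m := by
  have hya := apply_eq_zero_of_mem_box hy (notMem_erase a A)
  rw [mem_box_iff] at hy ⊢
  refine ⟨Finsupp.support_add.trans (union_subset (hy.1.trans (erase_subset a A))
    (Finsupp.support_single_subset.trans (singleton_subset_iff.2 ha))), fun i hi => ?_⟩
  obtain rfl | hia := eq_or_ne i a
  · simpa [hya] using hc
  · simpa [hia] using hy.2 i (mem_erase.2 ⟨hia, hi⟩)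

theorem sum_box_eq_sum_erase [AddCommMonoid R] (ha : a ∈ A) (f : (ι →₀ ℕ) → R) :
    ∑ x ∈ box A m, f x = ∑ y ∈ box (A.erase a) m, ∑ c ∈ range m, f (y + Finsupp.single a c) := by
  rw [← sum_product']
  refine sum_bij' (fun x _ => (x.erase a, x a)) (fun p _ => p.1 + Finsupp.single a p.2)
    (fun x hx => mem_product.2 ⟨erase_mem_box hx, mem_range.2 ((mem_box_iff.1 hx).2 a ha)⟩)
    (fun p hp => ?_) (fun x _ => Finsupp.erase_add_single a x) (fun p hp => ?_)
    fun x _ => by rw [Finsupp.erase_add_single]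
  · obtain ⟨hy, hc⟩ := mem_product.1 hp
    exact add_single_mem_box ha hy (mem_range.1 hc)
  · have hpa := apply_eq_zero_of_mem_box (mem_product.1 hp).1 (notMem_erase a A)
    ext1
    · rw [Finsupp.erase_add, Finsupp.erase_single, add_zero,
        Finsupp.erase_of_notMem_support (Finsupp.notMem_support_iff.2 hpa)]
    · simp [hpa]

variable [Ring R] [CharP R 2]

theorem sum_range_add_add_self (f : ℕ → R) (m : ℕ) :
    ∑ c ∈ range m, (f (c + 1) + f c) = f m + f 0 := by
  simpa only [CharTwo.sub_eq_add] using sum_range_sub f m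

theorem sum_box_add_single_add_self (ha : a ∈ A) (f : (ι →₀ ℕ) → R) :
    ∑ x ∈ box A m, (f (x + Finsupp.single a 1) + f x) =
      ∑ y ∈ box (A.erase a) m, (f (y + Finsupp.single a m) + f y) := by
  rw [sum_box_eq_sum_erase ha]
  refine sum_congr rfl fun y _ => ?_
  simpa [add_assoc, ← Finsupp.single_add] using
    sum_range_add_add_self (fun c => f (y + Finsupp.single a c)) m

theorem sum_box_cubeSum_coboundary {k : ℕ} (A : Finset ι) (φ : (Fin (k + 1) → ι →₀ ℕ) → R) :
    ∑ x ∈ box A m, cubeSum (Finsupp.single · 1) (k + 1) A (coboundary φ) x =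
      ∑ a ∈ A, ∑ y ∈ box (A.erase a) m,
        (cubeSum (Finsupp.single · 1) k (A.erase a) φ (y + Finsupp.single a m) +
          cubeSum (Finsupp.single · 1) k (A.erase a) φ y) := by
  simp only [cubeSum_coboundary]
  rw [sum_comm]
  exact sum_congr rfl fun a ha => sum_box_add_single_add_self ha _

end Box

section Det

variable {X R : Type*} [CommRing R]

/-- The determinant of the values of `h 0, …, h k` at the vertices of the simplex `w`, as a
cochain. -/
def evalDet (h : ℕ → X → R) (k : ℕ) (w : Fin (k + 1) → X) : R :=
  Matrix.det (.of fun i j : Fin (k + 1) => h i (w j))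

theorem evalDet_succ_eq_coboundary [CharP R 2] {h : ℕ → X → R} {k : ℕ} {w : Fin (k + 2) → X}
    (hw : ∀ j, h (k + 1) (w j) = 1) : evalDet h (k + 1) w = coboundary (evalDet h k) w := by
  rw [evalDet, Matrix.det_succ_row _ (Fin.last (k + 1)), coboundary]
  refine sum_congr rfl fun j _ => ?_
  simp [hw, CharTwo.neg_eq, evalDet, Fin.removeNth, Matrix.submatrix]

theorem evalDet_eq_zero_of_row_eq {h : ℕ → X → R} {k : ℕ} {w : Fin (k + 1) → X} {i : ℕ}
    (hi : i < k) (hw : ∀ j, h i (w j) = h (i + 1) (w j)) : evalDet h k w = 0 :=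
  Matrix.det_zero_of_row_eq (i := ⟨i, by omega⟩) (j := ⟨i + 1, by omega⟩) (by simp) (funext hw)

end Det

section Sperner

/-- The indicator of `s 0 ∪ ⋯ ∪ s i`, with values in the field of the cochain sums. Unlike the
indicators of the single sets `s i`, these make the determinant `evalDet` vanish on every simplex
whose vertices all lie in, or all avoid, the same set. -/
noncomputable def accumulateIndicator {X : Type*} (s : ℕ → Set X) (i : ℕ) : X → ZMod 2 :=
  (Set.accumulate s i).indicator 1

variable {X : Type*} {s : ℕ → Set X} {x : X} {i : ℕ}

theorem accumulateIndicator_eq_one (h : x ∈ s i) {j : ℕ} (hij : i ≤ j) :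
    accumulateIndicator s j x = 1 :=
  Set.indicator_of_mem (Set.mem_accumulate.2 ⟨i, hij, h⟩) 1

theorem accumulateIndicator_zero (h : x ∉ s 0) : accumulateIndicator s 0 x = 0 :=
  Set.indicator_of_notMem (by rwa [Set.accumulate_zero_nat]) 1

theorem accumulateIndicator_succ (h : x ∉ s (i + 1)) :
    accumulateIndicator s (i + 1) x = accumulateIndicator s i x :=
  Set.indicator_eq_indicator (by simp only [Set.accumulate_succ, Set.mem_union, h, or_false]) rfl

theorem accumulateIndicator_congr {y : X} (h : ∀ j, x ∈ s j ↔ y ∈ s j) (i : ℕ) :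
    accumulateIndicator s i x = accumulateIndicator s i y :=
  Set.indicator_eq_indicator (by simp only [Set.mem_accumulate, h]) rfl

variable {k : ℕ} {w : Fin (k + 1) → X}

theorem evalDet_accumulateIndicator_eq_zero_of_forall_mem (hik : i < k) (hw : ∀ j, w j ∈ s i) :
    evalDet (accumulateIndicator s) k w = 0 :=
  evalDet_eq_zero_of_row_eq hik fun j => by
    rw [accumulateIndicator_eq_one (hw j) le_rfl, accumulateIndicator_eq_one (hw j) i.le_succ]

theorem evalDet_accumulateIndicator_eq_zero_of_forall_notMem (hik : i ≤ k)
    (hw : ∀ j, w j ∉ s i) : evalDet (accumulateIndicator s) k w = 0 := by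
  cases i with
  | zero => exact Matrix.det_eq_zero_of_row_eq_zero 0 fun j => accumulateIndicator_zero (hw j)
  | succ i => exact evalDet_eq_zero_of_row_eq hik fun j => (accumulateIndicator_succ (hw j)).symm

end Sperner

section Grid

theorem add_sum_single_apply {ι : Type*} [DecidableEq ι] (x : ι →₀ ℕ) (B : Finset ι) (i : ι) :
    (x + ∑ b ∈ B, Finsupp.single b 1 : ι →₀ ℕ) i = x i + if i ∈ B then 1 else 0 := by
  simp [Finsupp.single_apply]

theorem cubeSum_eq_zero_of_notMem {ι R : Type*} [DecidableEq ι] [AddCommMonoid R] {k : ℕ}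
    {A : Finset ι} {a : ι} (ha : a ∉ A) {φ : (Fin (k + 1) → ι →₀ ℕ) → R} {x : ι →₀ ℕ}
    (h : ∀ w, (∀ j, w j a = x a) → φ w = 0) : cubeSum (Finsupp.single · 1) k A φ x = 0 := by
  refine cubeSum_eq_zero fun w hw => h w fun j => ?_
  obtain ⟨B, hB, hwj⟩ := hw j
  rw [hwj, add_sum_single_apply, if_neg fun haB => ha (hB haB), add_zero]

variable {n m k : ℕ} {s : ℕ → Set (ℕ →₀ ℕ)} {A : Finset ℕ} {a : ℕ}

theorem cubeSum_evalDet_near_face (h_near : ∀ i x, x i = 0 → x ∈ s i) (hak : a < k) (ha : a ∉ A)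
    {y : ℕ →₀ ℕ} (hy : y ∈ box A m) :
    cubeSum (Finsupp.single · 1) k A (evalDet (accumulateIndicator s) k) y = 0 :=
  cubeSum_eq_zero_of_notMem ha fun _ hw =>
    evalDet_accumulateIndicator_eq_zero_of_forall_mem hak fun j =>
      h_near a _ ((hw j).trans (apply_eq_zero_of_mem_box hy ha))

theorem cubeSum_evalDet_far_face (h_far : ∀ x : ℕ →₀ ℕ, x a = m → x ∉ s a) (hak : a ≤ k)
    (ha : a ∉ A) {y : ℕ →₀ ℕ} (hy : y ∈ box A m) :
    cubeSum (Finsupp.single · 1) k A (evalDet (accumulateIndicator s) k)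
      (y + Finsupp.single a m) = 0 :=
  cubeSum_eq_zero_of_notMem ha fun w hw =>
    evalDet_accumulateIndicator_eq_zero_of_forall_notMem hak fun j => h_far _ <| by
      rw [hw, Finsupp.add_apply, apply_eq_zero_of_mem_box hy ha, Finsupp.single_eq_same, zero_add]

theorem cubeSum_evalDet_succ (h_near : ∀ i x, x i = 0 → x ∈ s i) (hA : k + 1 ∉ A)
    {x : ℕ →₀ ℕ} (hx : x ∈ box A m) :
    cubeSum (Finsupp.single · 1) (k + 1) A (evalDet (accumulateIndicator s) (k + 1)) x =
      cubeSum (Finsupp.single · 1) (k + 1) A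
        (coboundary (evalDet (accumulateIndicator s) k)) x := by
  refine cubeSum_congr fun w hw => evalDet_succ_eq_coboundary fun j =>
    accumulateIndicator_eq_one (h_near _ _ ?_) le_rfl
  obtain ⟨B, hB, hwj⟩ := hw j
  rw [hwj, add_sum_single_apply, apply_eq_zero_of_mem_box hx hA, if_neg fun h => hA (hB h)]

theorem sum_box_cubeSum_evalDet_eq_one (h_near : ∀ i x, x i = 0 → x ∈ s i)
    (h_far : ∀ i < n, ∀ x, x i = m → x ∉ s i) (hk : k ≤ n) :
    ∑ x ∈ box (range k) m,
      cubeSum (Finsupp.single · 1) k (range k) (evalDet (accumulateIndicator s) k) x = 1 := by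
  induction k with
  | zero =>
    have box_range_zero : box (range 0) m = {0} := by
      ext x
      simp [mem_box_iff]
    rw [box_range_zero, sum_singleton, cubeSum, evalDet, Matrix.det_fin_one]
    exact accumulateIndicator_eq_one (h_near 0 0 rfl) le_rfl
  | succ k ih =>
    let face (a : ℕ) : Finset ℕ := (range (k + 1)).erase a
    let S (A : Finset ℕ) : (ℕ →₀ ℕ) → ZMod 2 :=
      cubeSum (Finsupp.single · 1) k A (evalDet (accumulateIndicator s) k)
    calc
      _ = ∑ a ∈ range (k + 1), ∑ y ∈ box (face a) m,
            (S (face a) (y + Finsupp.single a m) + S (face a) y) := by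
        rw [sum_congr rfl fun x hx => cubeSum_evalDet_succ h_near notMem_range_self hx,
          sum_box_cubeSum_coboundary]
      _ = ∑ a ∈ range (k + 1), ∑ y ∈ box (face a) m, S (face a) y := by
        refine sum_congr rfl fun a ha => sum_congr rfl fun y hy => ?_
        have hak := mem_range.1 ha
        rw [add_eq_right]
        exact cubeSum_evalDet_far_face (h_far a (by omega)) (by omega) (notMem_erase a _) hy
      _ = ∑ y ∈ box (range k) m, S (range k) y := by
        have near_faces : ∑ a ∈ range k, ∑ y ∈ box (face a) m, S (face a) y = 0 :=
          sum_eq_zero fun a ha => sum_eq_zero fun y hy =>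
            cubeSum_evalDet_near_face h_near (mem_range.1 ha) (notMem_erase a _) hy
        have face_last : face k = range k := by
          rw [← erase_insert notMem_range_self, ← range_add_one]
        rw [sum_range_succ, near_faces, zero_add, face_last]
      _ = 1 := ih (by omega)

theorem exists_cell_injective_memberships (h_near : ∀ i x, x i = 0 → x ∈ s i)
    (h_far : ∀ i < n, ∀ x, x i = m → x ∉ s i) :
    ∃ (x : ℕ →₀ ℕ) (w : Fin (n + 1) → ℕ →₀ ℕ), (∀ j l, x l ≤ w j l ∧ w j l ≤ x l + 1) ∧
      Function.Injective fun j => {i | w j ∈ s i} := by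
  obtain ⟨x, -, hx⟩ := exists_ne_zero_of_sum_ne_zero
    ((sum_box_cubeSum_evalDet_eq_one h_near h_far le_rfl).symm ▸ one_ne_zero)
  obtain ⟨w, hw, hdet⟩ : ∃ w : Fin (n + 1) → ℕ →₀ ℕ,
      (∀ j, ∃ B ⊆ range n, w j = x + ∑ b ∈ B, Finsupp.single b 1) ∧
        evalDet (accumulateIndicator s) n w ≠ 0 := by
    by_contra! h
    exact hx (cubeSum_eq_zero h)
  refine ⟨x, w, fun j l => ?_, fun i j hij => ?_⟩
  · obtain ⟨B, -, hwj⟩ := hw j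
    rw [hwj, add_sum_single_apply]
    split_ifs <;> omega
  · by_contra hne
    exact hdet <| Matrix.det_zero_of_column_eq hne fun k =>
      accumulateIndicator_congr (fun l => iff_of_eq (congrFun hij l)) k

end Grid

section Colouring

variable {n m k : ℕ}

/-- The indices `u` and `v` belong to cubes that meet: they differ by at most `1` in each
coordinate. -/
def IsNear (u v : Fin n → Fin k) : Prop :=
  ∀ s, (u s : ℕ) ≤ v s + 1 ∧ (v s : ℕ) ≤ u s + 1

instance (u v : Fin n → Fin k) : Decidable (IsNear u v) :=
  inferInstanceAs (Decidable (∀ _, _))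

theorem IsNear.refl (u : Fin n → Fin k) : IsNear u u :=
  fun _ => ⟨Nat.le_succ _, Nat.le_succ _⟩

theorem IsNear.symm {u v : Fin n → Fin k} (h : IsNear u v) : IsNear v u :=
  fun s => (h s).symm

theorem exists_isNear_injective_comp {γ : Type*} (c : (Fin n → Fin (m + 1)) → γ)
    (hc : ∀ i u v, u i = 0 → v i = Fin.last m → c u ≠ c v) :
    ∃ u : Fin (n + 1) → Fin n → Fin (m + 1),
      (∀ i j, IsNear (u i) (u j)) ∧ Function.Injective (c ∘ u) := by
  let index (x : ℕ →₀ ℕ) : Fin n → Fin (m + 1) := fun s => Fin.clamp (x s) m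
  let s (i : ℕ) : Set (ℕ →₀ ℕ) := {x | ∀ hi : i < n, ∃ v, c (index x) = c v ∧ v ⟨i, hi⟩ = 0}
  have h_near (i x) (hx : x i = 0) : x ∈ s i := fun _ =>
    ⟨index x, rfl, by ext; simp [index, hx]⟩
  have h_far (i) (hi : i < n) (x : ℕ →₀ ℕ) (hx : x i = m) : x ∉ s i := fun h => by
    obtain ⟨v, hcv, hv⟩ := h hi
    exact hc _ v (index x) hv (by ext; simp [index, hx]) hcv.symm
  obtain ⟨x, w, hxw, hs⟩ := exists_cell_injective_memberships h_near h_far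
  refine ⟨fun j => index (w j), fun i j l => ?_, fun i j hij => hs ?_⟩
  · have := hxw i l
    have := hxw j l
    simp only [index, Fin.coe_clamp]
    omega
  · have hcij : c (index (w i)) = c (index (w j)) := hij
    simp only [s, Set.mem_ofPred_eq, hcij]

/-- The graph on the cube indices whose connected components correspond to the components of the
unions of equally coloured cubes, for the colouring `g`. -/
def monochromaticGraph {β : Type*} (g : (Fin n → Fin k) → β) : SimpleGraph (Fin n → Fin k) where
  Adj u v := u ≠ v ∧ IsNear u v ∧ g u = g v
  symm := ⟨fun _ _ h => ⟨h.1.symm, h.2.1.symm, h.2.2.symm⟩⟩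
  loopless := ⟨fun _ h => h.1 rfl⟩

theorem IsNear.reachable {β : Type*} {g : (Fin n → Fin k) → β} {u v : Fin n → Fin k}
    (h : IsNear u v) (hg : g u = g v) : (monochromaticGraph g).Reachable u v := by
  obtain rfl | hne := eq_or_ne u v
  · rfl
  · exact SimpleGraph.Adj.reachable ⟨hne, h, hg⟩

theorem apply_eq_of_reachable {β : Type*} {g : (Fin n → Fin k) → β} {u v : Fin n → Fin k}
    (h : (monochromaticGraph g).Reachable u v) : g u = g v := by
  rw [SimpleGraph.reachable_iff_reflTransGen] at h
  induction h with
  | refl => rfl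
  | tail _ hadj ih => exact ih.trans hadj.2.2

theorem exists_isNear_injective_comp_of_forall_not_reachable {β : Type*}
    (g : (Fin n → Fin (m + 1)) → β)
    (h : ∀ i u v, u i = 0 → v i = Fin.last m → ¬ (monochromaticGraph g).Reachable u v) :
    ∃ u : Fin (n + 1) → Fin n → Fin (m + 1),
      (∀ i j, IsNear (u i) (u j)) ∧ Function.Injective (g ∘ u) := by
  obtain ⟨u, hu, hinj⟩ := exists_isNear_injective_comp (monochromaticGraph g).connectedComponentMk
    fun i u v hu hv huv => h i u v hu hv (SimpleGraph.ConnectedComponent.exact huv)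
  exact ⟨u, hu, fun i j hij =>
    hinj (SimpleGraph.ConnectedComponent.sound ((hu i j).reachable hij))⟩

end Colouring

section Cube

variable {n m k : ℕ}

theorem zero_le_topDim_iff {A : Set (Fin n → ℝ)} :
    ((0 : ℕ) : WithBot ℕ∞) ≤ topDim A ↔ A.Nonempty := by
  rw [topDim, ← not_lt, smallInductiveDimension_lt_iff, hasSmallInductiveDimensionLT_zero_iff,
    Set.isEmpty_coe_sort, Set.nonempty_iff_ne_empty]

theorem isClosed_cube (u : Fin n → Fin k) : IsClosed (cube n k u) :=
  isClosed_set_pi fun _ _ => isClosed_Icc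

theorem natCast_pos_of_index (u : Fin n → Fin k) (i : Fin n) : (0 : ℝ) < k :=
  Nat.cast_pos.2 (u i).pos

theorem cube_nonempty (u : Fin n → Fin k) : (cube n k u).Nonempty :=
  Set.univ_pi_nonempty_iff.2 fun _ =>
    Set.nonempty_Icc.2 (div_le_div_of_nonneg_right (by linarith) k.cast_nonneg)

theorem isConnected_cube (u : Fin n → Fin k) : IsConnected (cube n k u) :=
  ⟨cube_nonempty u, isPreconnected_univ_pi fun _ => isPreconnected_Icc⟩

theorem cube_subset_unitCube (u : Fin n → Fin k) : cube n k u ⊆ unitCube n := by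
  refine Set.pi_mono fun s _ => Set.Icc_subset_Icc (by positivity) ?_
  rw [div_le_one (natCast_pos_of_index u s)]
  exact_mod_cast (u s).2

theorem cube_inter_cube_nonempty_iff {u v : Fin n → Fin k} :
    (cube n k u ∩ cube n k v).Nonempty ↔ IsNear u v := by
  rw [cube, cube, ← Set.pi_inter_distrib, Set.univ_pi_nonempty_iff]
  refine forall_congr' fun s => ?_
  have hk := natCast_pos_of_index u s
  rw [Set.Icc_inter_Icc, Set.nonempty_Icc, sup_le_iff, le_inf_iff, le_inf_iff]
  simp only [div_le_div_iff_of_pos_right hk]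
  norm_cast
  omega

theorem exists_mem_cube_apply_eq_iff {u : Fin n → Fin k} {i : Fin n} {c : ℝ} :
    (∃ z ∈ cube n k u, z i = c) ↔ (u i : ℝ) ≤ c * k ∧ c * k ≤ u i + 1 := by
  have hk := natCast_pos_of_index u i
  rw [← div_le_iff₀ hk, ← le_div_iff₀ hk]
  exact Set.ext_iff.1 (Set.eval_image_univ_pi (cube_nonempty u)) c

theorem exists_mem_cube_apply_eq_zero_iff {u : Fin n → Fin (m + 1)} {i : Fin n} :
    (∃ z ∈ cube n (m + 1) u, z i = 0) ↔ u i = 0 := by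
  rw [exists_mem_cube_apply_eq_iff, zero_mul, ← Fin.val_eq_zero_iff,
    Nat.cast_nonpos]
  exact and_iff_left (by positivity)

theorem exists_mem_cube_apply_eq_one_iff {u : Fin n → Fin (m + 1)} {i : Fin n} :
    (∃ z ∈ cube n (m + 1) u, z i = 1) ↔ u i = Fin.last m := by
  rw [exists_mem_cube_apply_eq_iff, one_mul, Fin.ext_iff, Fin.val_last]
  norm_cast
  omega

end Cube

section Component

variable {n m k : ℕ} {β : Type*} {g : (Fin n → Fin (m + 1)) → β} {i : Fin n}

theorem isConnected_biUnion_reachable (g : (Fin n → Fin k) → β) (u : Fin n → Fin k) :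
    IsConnected (⋃ v ∈ {v | (monochromaticGraph g).Reachable u v}, cube n k v) := by
  refine IsConnected.biUnion_of_reflTransGen ⟨u, .refl u⟩ (fun v _ => isConnected_cube v)
    fun v hv w hw => ?_
  induction (SimpleGraph.reachable_iff_reflTransGen v w).1 (hv.symm.trans hw) with
  | refl => exact .refl
  | tail hvx hxy ih =>
    have hux := hv.trans ((SimpleGraph.reachable_iff_reflTransGen _ _).2 hvx)
    exact (ih hux).tail ⟨cube_inter_cube_nonempty_iff.2 hxy.2.1, hux⟩

theorem connectsOppositeFaces_biUnion_reachable {u v : Fin n → Fin (m + 1)}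
    (huv : (monochromaticGraph g).Reachable u v) (hu : u i = 0) (hv : v i = Fin.last m) :
    ConnectsOppositeFaces i
      (⋃ w ∈ {w | (monochromaticGraph g).Reachable u w}, cube n (m + 1) w) := by
  obtain ⟨x, hx, hx0⟩ := exists_mem_cube_apply_eq_zero_iff.2 hu
  obtain ⟨y, hy, hy1⟩ := exists_mem_cube_apply_eq_one_iff.2 hv
  exact ⟨Set.iUnion₂_subset fun w _ => cube_subset_unitCube w, isConnected_biUnion_reachable g u,
    ⟨x, Set.mem_biUnion (.refl u) hx, cube_subset_unitCube u hx, hx0⟩,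
    ⟨y, Set.mem_biUnion huv hy, cube_subset_unitCube v hy, hy1⟩⟩

theorem reflTransGen_of_isPreconnected_biUnion {ι X : Type*} [TopologicalSpace X] {s : ι → Set X}
    {t : Set ι} (ht : t.Finite) (hs : ∀ i ∈ t, IsClosed (s i)) (h_ne : ∀ i ∈ t, (s i).Nonempty)
    (h : IsPreconnected (⋃ i ∈ t, s i)) {i j : ι} (hi : i ∈ t) (hj : j ∈ t) :
    Relation.ReflTransGen (fun a b => (s a ∩ s b).Nonempty ∧ a ∈ t ∧ b ∈ t) i j := by
  set R := Relation.ReflTransGen (fun a b => (s a ∩ s b).Nonempty ∧ a ∈ t ∧ b ∈ t) i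
  by_contra hij
  have isClosed_part (p : ι → Prop) : IsClosed (⋃ a ∈ {a ∈ t | p a}, s a) :=
    (ht.subset (Set.sep_subset t p)).isClosed_biUnion fun a ha => hs a ha.1
  have meets {p : ι → Prop} {a : ι} (ha : a ∈ t) (hpa : p a) :
      ((⋃ a ∈ t, s a) ∩ ⋃ a ∈ {a ∈ t | p a}, s a).Nonempty :=
    (h_ne a ha).mono fun z hz =>
      ⟨Set.mem_biUnion ha hz, Set.mem_biUnion (show a ∈ {a ∈ t | p a} from ⟨ha, hpa⟩) hz⟩
  have cover : ⋃ a ∈ t, s a ⊆ (⋃ a ∈ {a ∈ t | R a}, s a) ∪ ⋃ a ∈ {a ∈ t | ¬ R a}, s a := by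
    rw [← Set.biUnion_union]
    exact Set.biUnion_subset_biUnion_left fun a ha => (em (R a)).imp (⟨ha, ·⟩) (⟨ha, ·⟩)
  obtain ⟨z, -, hz, hz'⟩ := isPreconnected_closed_iff.1 h _ _ (isClosed_part R)
    (isClosed_part (¬ R ·)) cover (meets hi .refl) (meets hj hij)
  obtain ⟨a, ⟨ha, hRa⟩, hza⟩ := Set.mem_iUnion₂.1 hz
  obtain ⟨b, ⟨hb, hRb⟩, hzb⟩ := Set.mem_iUnion₂.1 hz'
  exact hRb (hRa.tail ⟨⟨z, hza, hzb⟩, ha, hb⟩)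

theorem exists_reachable_of_connectsOppositeFaces {U : Set (Fin n → Fin (m + 1))}
    (hU : ∀ u ∈ U, ∀ v ∈ U, g u = g v)
    (h : ConnectsOppositeFaces i (⋃ u ∈ U, cube n (m + 1) u)) :
    ∃ u v, u i = 0 ∧ v i = Fin.last m ∧ (monochromaticGraph g).Reachable u v := by
  obtain ⟨-, h_conn, ⟨x, hx, -, hx0⟩, ⟨y, hy, -, hy1⟩⟩ := h
  obtain ⟨u, hu, hxu⟩ := Set.mem_iUnion₂.1 hx
  obtain ⟨v, hv, hyv⟩ := Set.mem_iUnion₂.1 hy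
  refine ⟨u, v, exists_mem_cube_apply_eq_zero_iff.1 ⟨x, hxu, hx0⟩,
    exists_mem_cube_apply_eq_one_iff.1 ⟨y, hyv, hy1⟩, ?_⟩
  have chain := reflTransGen_of_isPreconnected_biUnion U.toFinite (fun w _ => isClosed_cube w)
    (fun w _ => cube_nonempty w) h_conn.isPreconnected hu hv
  clear hv hyv
  induction chain with
  | refl => rfl
  | tail _ hab ih =>
    exact ih.trans ((cube_inter_cube_nonempty_iff.1 hab.1).reachable (hU _ hab.2.1 _ hab.2.2))

end Component

section UpperBound

theorem admissibleConst_of_partition {n : ℕ} {C : ℝ} {β : Type*} (b : (Fin (n - 1) → ℤ) → β)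
    (P : β → Finset (Fin (n - 1) → ℤ)) (mem_P : ∀ p, p ∈ P (b p))
    (hP : ∀ x, RConnected 1 (P x : Set (Fin (n - 1) → ℤ))) (hC : ∀ x, ((P x).card : ℝ) ≤ C)
    (hb : ∀ p : Fin (n + 1) → Fin (n - 1) → ℤ, (∀ i j, ‖p i - p j‖ ≤ 1) →
      ¬ Function.Injective (b ∘ p)) :
    AdmissibleConst n 0 C := by
  intro k hk F hF
  obtain ⟨m, rfl⟩ := Nat.exists_eq_add_of_le' hk
  let K (u : Fin n → Fin (m + 1)) : cubes n (m + 1) := ⟨cube n (m + 1) u, u, rfl⟩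
  let G := monochromaticGraph fun u => b (F (K u))
  obtain ⟨i, u, v, hu, hv, huv⟩ : ∃ i u v, u i = 0 ∧ v i = Fin.last m ∧ G.Reachable u v := by
    by_contra! h
    obtain ⟨u, hu, hinj⟩ := exists_isNear_injective_comp_of_forall_not_reachable _ h
    exact hb (fun j => F (K (u j))) (fun j l => hF _ _ <|
      zero_le_topDim_iff.2 (cube_inter_cube_nonempty_iff.2 (hu j l))) hinj
  refine ⟨P (b (F (K u))), hP _, hC _, K '' {w | G.Reachable u w}, ?_, i, ?_⟩
  · rintro _ ⟨w, huw, rfl⟩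
    rw [apply_eq_of_reachable huw]
    exact mem_P _
  · rw [Set.biUnion_image]
    exact connectsOppositeFaces_biUnion_reachable huv hu hv

/-- The index of the domino that contains `p` in the brick wall tiling of `ℤ²`, whose rows are
tiled by horizontal dominoes and whose consecutive rows are shifted by one. -/
def brick (p : Fin 2 → ℤ) : ℤ × ℤ :=
  ((p 0 + p 1) / 2, p 1)

/-- The two points of the domino with index `b`. -/
def brickPoints (b : ℤ × ℤ) : Finset (Fin 2 → ℤ) :=
  {![2 * b.1 - b.2, b.2], ![2 * b.1 - b.2 + 1, b.2]}

theorem mem_brickPoints_brick (p : Fin 2 → ℤ) : p ∈ brickPoints (brick p) := by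
  have row (c : ℤ) (hc : p 0 = c) : p = ![c, p 1] := by
    ext s
    fin_cases s
    exacts [hc, rfl]
  rw [brickPoints, mem_insert, mem_singleton]
  obtain h | h := Int.emod_two_eq_zero_or_one (p 0 + p 1)
  · exact .inl (row _ (by simp only [brick]; omega))
  · exact .inr (row _ (by simp only [brick]; omega))

theorem rConnected_of_dist_le {X : Type*} [MetricSpace X] {r : ℝ} {S : Set X}
    (h : ∀ x ∈ S, ∀ y ∈ S, dist x y ≤ r) : RConnected r S := by
  refine fun x hx y hy => ⟨1, ![x, y], ?_, rfl, rfl, ?_⟩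
  · exact Fin.forall_fin_two.2 ⟨hx, hy⟩
  · exact Fin.forall_fin_one.2 (h x hx y hy)

theorem norm_sub_le_one_iff {ι : Type*} [Fintype ι] {p q : ι → ℤ} :
    ‖p - q‖ ≤ 1 ↔ ∀ s, |p s - q s| ≤ 1 := by
  simp only [pi_norm_le_iff_of_nonneg zero_le_one, Pi.sub_apply, Int.norm_eq_abs]
  norm_cast

theorem rConnected_brickPoints (b : ℤ × ℤ) :
    RConnected 1 (brickPoints b : Set (Fin 2 → ℤ)) := by
  refine rConnected_of_dist_le fun x hx y hy => ?_
  rw [dist_eq_norm, norm_sub_le_one_iff, Fin.forall_fin_two]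
  simp only [brickPoints, coe_insert, coe_singleton, Set.mem_insert_iff,
    Set.mem_singleton_iff] at hx hy
  rcases hx with rfl | rfl <;> rcases hy with rfl | rfl <;> simp

/-- In one of the two rows of a `2 × 2` block, both points lie in the same domino, so that the
block meets at most three dominoes. -/
theorem not_injective_brick_comp {p : Fin 4 → Fin 2 → ℤ} (hp : ∀ i j, ‖p i - p j‖ ≤ 1) :
    ¬ Function.Injective (brick ∘ p) := by
  have block (s) : ∃ c, ∀ j, p j s = c ∨ p j s = c + 1 := by
    obtain ⟨i, hi⟩ := Finite.exists_min fun j => p j s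
    refine ⟨p i s, fun j => ?_⟩
    have := (abs_le.1 (norm_sub_le_one_iff.1 (hp j i) s)).2
    have := hi j
    omega
  obtain ⟨x, hx⟩ := block 0
  obtain ⟨y, hy⟩ := block 1
  let dominoes : Finset (ℤ × ℤ) := {((x + y) / 2, y), ((x + y + 1) / 2, y),
    ((x + y + 1) / 2, y + 1), ((x + y + 2) / 2, y + 1)}
  have mem_dominoes (j) : brick (p j) ∈ dominoes := by
    simp only [dominoes, brick, mem_insert, mem_singleton, Prod.mk.injEq]
    have := hx j
    have := hy j
    omega
  have card_dominoes : dominoes.card ≤ 3 := by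
    obtain h | h := Int.emod_two_eq_zero_or_one (x + y)
    · rw [show dominoes = {((x + y) / 2, y), ((x + y + 1) / 2, y + 1), ((x + y + 2) / 2, y + 1)} by
        simp only [dominoes, show (x + y + 1) / 2 = (x + y) / 2 by omega, insert_idem]]
      exact card_le_three
    · rw [show dominoes = {((x + y) / 2, y), ((x + y + 1) / 2, y), ((x + y + 1) / 2, y + 1)} by
        simp only [dominoes, show (x + y + 2) / 2 = (x + y + 1) / 2 by omega, pair_eq_singleton]]
      exact card_le_three
  intro h_inj
  have := card_le_card_of_injOn (s := univ) (brick ∘ p) (fun j _ => mem_dominoes j) h_inj.injOn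
  rw [card_fin] at this
  omega

end UpperBound

section LowerBound

theorem two_le_of_admissibleConst {n m d : ℕ} {γ : Type*} {g : (Fin n → Fin (m + 1)) → γ}
    (hg : ∀ i u v, u i = 0 → v i = Fin.last m → ¬ (monochromaticGraph g).Reachable u v)
    {a : γ → Fin (n - 1) → ℤ} (ha : Function.Injective a) (h_norm : ∀ x y, ‖a x - a y‖ ≤ 1)
    {C : ℝ} (hC : AdmissibleConst n d C) : 2 ≤ C := by
  choose index h_index using fun K : cubes n (m + 1) => K.2
  obtain ⟨P, -, hPC, 𝒮, h𝒮, i, h_faces⟩ := hC (m + 1) m.succ_pos (fun K => a (g (index K)))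
    fun _ _ _ => h_norm _ _
  refine le_trans ?_ hPC
  by_contra! hP
  have hP : P.card ≤ 1 := Nat.lt_succ_iff.1 (by exact_mod_cast hP)
  have reindex : ⋃ K ∈ 𝒮, (K : Set (Fin n → ℝ)) = ⋃ u ∈ index '' 𝒮, cube n (m + 1) u := by
    simp only [Set.biUnion_image, h_index]
  have constant : ∀ u ∈ index '' 𝒮, ∀ v ∈ index '' 𝒮, g u = g v := by
    rintro _ ⟨K, hK, rfl⟩ _ ⟨L, hL, rfl⟩
    exact ha (card_le_one.1 hP _ (h𝒮 hK) _ (h𝒮 hL))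
  obtain ⟨u, v, hu, hv, huv⟩ := exists_reachable_of_connectsOppositeFaces constant
    (reindex ▸ h_faces)
  exact hg i u v hu hv huv

theorem IsNear.of_reachable {n k : ℕ} {γ : Type*} {g : (Fin n → Fin k) → γ}
    (hg : ∀ u v w, g u = g v → g v = g w → IsNear u v → IsNear v w → IsNear u w)
    {u v : Fin n → Fin k} (huv : (monochromaticGraph g).Reachable u v) : IsNear u v := by
  rw [SimpleGraph.reachable_iff_reflTransGen] at huv
  induction huv with
  | refl => exact .refl u
  | tail hux hxy ih =>
    have hux := apply_eq_of_reachable ((SimpleGraph.reachable_iff_reflTransGen _ _).2 hux)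
    exact hg _ _ _ hux hxy.2.2 ih hxy.2.1

/-- A colouring of the `27` cubes of `𝒦_3^3` by four colours, found so that cubes of the same colour
that are joined by a chain of intersecting cubes of this colour already intersect. -/
def fourColouring (u : Fin 3 → Fin 3) : Fin 4 :=
  ![![![0, 0, 2], ![1, 1, 2], ![2, 0, 0]],
    ![![3, 3, 2], ![1, 1, 2], ![1, 1, 3]],
    ![![3, 0, 0], ![2, 0, 0], ![2, 3, 3]]] (u 0) (u 1) (u 2)

/-- The four colours as the points of a `2 × 2` block of `ℤ²`. -/
def colourPoint : Fin 4 → Fin 2 → ℤ :=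
  ![![0, 0], ![1, 0], ![0, 1], ![1, 1]]

theorem colourPoint_injective : Function.Injective colourPoint := by
  decide

theorem norm_colourPoint_sub_le (a b : Fin 4) : ‖colourPoint a - colourPoint b‖ ≤ 1 := by
  rw [norm_sub_le_one_iff]
  revert a b
  decide

set_option maxRecDepth 100000 in
theorem isNear_trans_of_fourColouring_eq : ∀ u v w, fourColouring u = fourColouring v →
    fourColouring v = fourColouring w → IsNear u v → IsNear v w → IsNear u w := by
  -- With the premises on `u` and `v` before the quantifier over `w`, `decide` prunes most triples.
  have early_premises : ∀ v₀ v₁ v₂ u₀ u₁ u₂ : Fin 3,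
      fourColouring ![u₀, u₁, u₂] = fourColouring ![v₀, v₁, v₂] →
      IsNear ![u₀, u₁, u₂] ![v₀, v₁, v₂] → ∀ w₀ w₁ w₂ : Fin 3,
      fourColouring ![v₀, v₁, v₂] = fourColouring ![w₀, w₁, w₂] →
      IsNear ![v₀, v₁, v₂] ![w₀, w₁, w₂] → IsNear ![u₀, u₁, u₂] ![w₀, w₁, w₂] := by
    decide
  simp only [Fin.forall_fin_succ_pi, Fin.forall_fin_zero_pi]
  intro u₀ u₁ u₂ v₀ v₁ v₂ w₀ w₁ w₂ huv hvw near_uv near_vw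
  exact early_premises _ _ _ _ _ _ huv near_uv _ _ _ hvw near_vw

theorem not_reachable_fourColouring (i : Fin 3) (u v : Fin 3 → Fin 3) (hu : u i = 0)
    (hv : v i = Fin.last 2) : ¬ (monochromaticGraph fourColouring).Reachable u v := by
  intro huv
  have h_near := (IsNear.of_reachable isNear_trans_of_fourColouring_eq huv i).2
  rw [hu, hv] at h_near
  exact absurd h_near (by decide)

end LowerBound

end Chessboard

theorem mainTheorem7 : Chessboard.IsOptimalConst 3 0 2 := by
  open Chessboard in
  refine ⟨⟨two_pos, admissibleConst_of_partition brick brickPoints mem_brickPoints_brick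
    rConnected_brickPoints (fun b => ?_) fun p hp => not_injective_brick_comp hp⟩,
    fun C hC => two_le_of_admissibleConst not_reachable_fourColouring colourPoint_injective
      norm_colourPoint_sub_le hC.2⟩
  exact_mod_cast Finset.card_le_two
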